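/- Let $n,r,d\in\mathbb{N}$, let $\mathbb{N}^r_d=\{\alpha\in\mathbb{N}^r:\alpha_1+\cdots+\alpha_r\le d\}$, let $A\in\mathbb{R}^{\mathbb{N}^r_d\times n}$, $b\in\mathbb{R}^{\mathbb{N}^r_d}$, $c\in\mathbb{R}^n$, and let $X\subseteq\mathbb{R}^n$ be a set (for instance a convex set such that $X$ and $X^*$ are semidefinite representable), with dual cone $X^*=\{u\in\mathbb{R}^n: u^Tx\ge 0\ \forall x\in X\}$. Let $\Gamma>0$, $\mu\in\mathbb{R}^r$, let $\Lambda\in\mathbb{R}^{r\times r}$ be symmetric positive definite, and put $$g(\xi)=\Gamma-(\xi-\mu)^T\Lambda^{-1}(\xi-\mu),\qquad U=\{\xi\in\mathbb{R}^r: g(\xi)\ge 0\}.$$ Let $[\xi]_d=(\xi^\alpha)_{\alpha\in\mathbb{N}^r_d}$ be the vector of monomials of degree at most $d$, and let $\mathscr{P}_d(U)$ be the cone of real polynomials of degree at most $d$ that are nonnegative on $U$. The robust approximation is the problem $$(P)\qquad f^{\min}=\min_{x\in X}\ c^Tx\quad\text{s.t.}\quad (Ax+b)^T[\xi]_d\in\mathscr{P}_d(U).$$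 For $k\ge k_0:=\max\{\lceil d/2\rceil,1\}$, let $\mathrm{QM}[g]_{2k}=\Sigma[\xi]_{2k}+g\cdot\Sigma[\xi]_{2k-\deg g}$, where $\Sigma[\xi]_{e}$ is the cone of sums of squares of polynomials having degree at most $e$. For $z\in\mathbb{R}^{\mathbb{N}^r_{2k}}$ let $\mathscr{L}_z\big(\sum_\alpha p_\alpha\xi^\alpha\big)=\sum_\alpha p_\alpha z_\alpha$ on polynomials of degree at most $2k$. For $0\le t\le k$ let $M_t[z]=(z_{\alpha+\beta})_{|\alpha|,|\beta|\le t}$ be the moment matrix, and let $L_g^{(k)}[z]=\big(\mathscr{L}_z(g\,\xi^{\alpha+\beta})\big)_{|\alpha|,|\beta|\le k-\lceil\deg(g)/2\rceil}$ be the localizing matrix. Let $\mathscr{S}[g]_{2k}=\{z: M_k[z]\succeq0,\ L_g^{(k)}[z]\succeq 0\}$, and consider the pair of relaxations of order $k$ $$(S_k)\qquad f_k^{sos}=\min_{x\in X}\ c^Tx\quad\text{s.t.}\quad (Ax+b)^T[\xi]_d\in \mathrm{QM}[g]_{2k}\cap\mathbb{R}[\xi]_d,$$ $$(M_k)\qquad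 f_k^{mom}=\max_{(y,z)}\ -b^Ty\quad\text{s.t.}\quad c-A^Ty\in X^*,\ \ y=z|_d:=(z_\alpha)_{\alpha\in\mathbb{N}^r_d},\ \ z\in\mathscr{S}[g]_{2k},$$ where optimal values are understood in $[-\infty,+\infty]$ as infima and suprema. Consider the following algorithm. Start with $k=k_0$. Step 1: solve $(S_k)$ and $(M_k)$ for optimizers $x^*$ and $(y^*,z^*)$ (any optimizers may be returned; if they do not both exist, replace $k$ by $k+1$ and repeat Step 1). Step 2: if $f_k^{sos}=f_k^{mom}$ and there is an integer $t\in[k_0,k]$ with $\operatorname{rank}M_t[z^*]=\operatorname{rank}M_{t-1}[z^*]$, then stop and output $x^*$ and $f^*=c^Tx^*$; otherwise replace $k$ by $k+1$ and go to Step 1. If this algorithm terminates after finitely many loops, then its output is correct: $x^*$ is an optimizer of $(P)$, and $f^*=c^Tx^*$ equals the optimal value $f^{\min}$ of $(P)$. -/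

import Mathlib

/-- The index set `ℕ^r_d` of exponents `α ∈ ℕ^r` with `α₁ + ⋯ + α_r ≤ d`. -/
abbrev MonIdx (r d : ℕ) : Type := {α : Fin r →₀ ℕ // α.degree ≤ d}

theorem finite_monIdx (r d : ℕ) : Finite (MonIdx r d) := by
  refine Finite.of_injective
    (fun (α : MonIdx r d) (i : Fin r) => (⟨α.1 i, ?_⟩ : Fin (d + 1))) ?_
  · exact Nat.lt_succ_of_le ((Finsupp.le_degree i α.1).trans α.2)
  · intro α β h
    apply Subtype.ext
    ext i
    simpa using congrFun h i

noncomputable instance instFintypeMonIdx (r d : ℕ) : Fintype (MonIdx r d) :=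
  @Fintype.ofFinite _ (finite_monIdx r d)

/-- Truncated multi-sequences of degree `e` in `r` variables. -/
abbrev Tms (r e : ℕ) : Type := MonIdx r e → ℝ

/-- The polynomial `v^T [ξ]_d` with coefficient vector `v`. -/
noncomputable def polyOfCoeffs {r d : ℕ} (v : MonIdx r d → ℝ) : MvPolynomial (Fin r) ℝ :=
  ∑ α : MonIdx r d, MvPolynomial.monomial α.1 (v α)

/-- The cone of sums of squares of degree at most `e`. -/
def sosTrunc (r e : ℕ) : Set (MvPolynomial (Fin r) ℝ) :=
  {p | IsSumSq p ∧ p.totalDegree ≤ e}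

/-- The truncated quadratic module `QM[g]_{2k}` of a single polynomial `g`
(meant for `deg g ≤ 2k`). -/
def qmodTrunc {r : ℕ} (g : MvPolynomial (Fin r) ℝ) (k : ℕ) : Set (MvPolynomial (Fin r) ℝ) :=
  {p | ∃ σ₀ ∈ sosTrunc r (2 * k), ∃ σ₁ ∈ sosTrunc r (2 * k - g.totalDegree), p = σ₀ + g * σ₁}

/-- The cone `P_d(U)` of polynomials of degree at most `d` that are nonnegative on `U`. -/
def nonnegPoly {r : ℕ} (U : Set (Fin r → ℝ)) (d : ℕ) : Set (MvPolynomial (Fin r) ℝ) :=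
  {p | p.totalDegree ≤ d ∧ ∀ ξ ∈ U, 0 ≤ MvPolynomial.eval ξ p}

/-- The Riesz functional of `z`, applied to polynomials of degree at most `e`. -/
noncomputable def riesz {r e : ℕ} (z : Tms r e) (p : MvPolynomial (Fin r) ℝ) : ℝ :=
  ∑ α : MonIdx r e, p.coeff α.1 * z α

/-- The truncation `z|_d = (z_α)_{|α| ≤ d}` (meant for `d ≤ e`). -/
noncomputable def Tms.truncate {r e : ℕ} (z : Tms r e) (d : ℕ) : Tms r d :=
  fun α => if h : α.1.degree ≤ e then z ⟨α.1, h⟩ else 0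

/-- The moment matrix `M_t[z]`, with entry `z_{α+β}` in position `(α, β)`, `|α|, |β| ≤ t`
(meant for `2t ≤ e`). -/
noncomputable def momentMatrix {r e : ℕ} (t : ℕ) (z : Tms r e) :
    Matrix (MonIdx r t) (MonIdx r t) ℝ :=
  Matrix.of fun α β => riesz z (MvPolynomial.monomial (α.1 + β.1) 1)

/-- The localizing matrix `L_g^{(k)}[z]`, with entry `L_z(g ξ^α ξ^β)` in position `(α, β)`,
`|α|, |β| ≤ k - ⌈deg g / 2⌉`  (meant for `deg g ≤ 2k ≤ e`). -/
noncomputable def localizingMatrix {r e : ℕ} (k : ℕ) (g : MvPolynomial (Fin r) ℝ) (z : Tms r e) :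
    Matrix (MonIdx r (k - (g.totalDegree + 1) / 2)) (MonIdx r (k - (g.totalDegree + 1) / 2)) ℝ :=
  Matrix.of fun α β => riesz z (g * MvPolynomial.monomial (α.1 + β.1) 1)

/-- The cone `S[g]_{2k}`. -/
def momentCone {r : ℕ} (g : MvPolynomial (Fin r) ℝ) (k : ℕ) : Set (Tms r (2 * k)) :=
  {z | (momentMatrix k z).PosSemidef ∧ (localizingMatrix k g z).PosSemidef}

/-- The dual cone `X^*` of a set `X ⊆ ℝ^n`. -/
def dualConeOf {n : ℕ} (X : Set (Fin n → ℝ)) : Set (Fin n → ℝ) :=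
  {u | ∀ x ∈ X, 0 ≤ u ⬝ᵥ x}

/-- The data of the robust approximation: minimize `c^T x` over `x ∈ X` such that
`(Ax + b)^T [ξ]_d` is nonnegative on the ellipsoid with size `Γ`, centre `μ`, shape `Λ`. -/
structure RobustProblem (n r d : ℕ) where
  A : Matrix (MonIdx r d) (Fin n) ℝ
  b : MonIdx r d → ℝ
  c : Fin n → ℝ
  X : Set (Fin n → ℝ)
  Γ : ℝ
  μ : Fin r → ℝ
  Λ : Matrix (Fin r) (Fin r) ℝ

/-- States of the algorithm: about to execute the loop of order `k`, or stopped with an output. -/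
inductive AlgState (n : ℕ) : Type
  | loop (k : ℕ) : AlgState n
  | output (x : Fin n → ℝ) (f : ℝ) : AlgState n

namespace RobustProblem

variable {n r d : ℕ} (P : RobustProblem n r d)

/-- The uncertainty set `U`. -/
def U : Set (Fin r → ℝ) :=
  {ξ | 0 ≤ P.Γ - (ξ - P.μ) ⬝ᵥ (P.Λ⁻¹.mulVec (ξ - P.μ))}

/-- The polynomial `g(ξ) = Γ - (ξ-μ)^T Λ⁻¹ (ξ-μ)`. -/
noncomputable def g : MvPolynomial (Fin r) ℝ :=
  MvPolynomial.C P.Γ - ∑ i, ∑ j, MvPolynomial.C (P.Λ⁻¹ i j) *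
    ((MvPolynomial.X i - MvPolynomial.C (P.μ i)) * (MvPolynomial.X j - MvPolynomial.C (P.μ j)))

/-- `h(x, ξ) = (Ax + b)^T [ξ]_d` as a polynomial in `ξ`. -/
noncomputable def h (x : Fin n → ℝ) : MvPolynomial (Fin r) ℝ :=
  polyOfCoeffs (P.A.mulVec x + P.b)

/-! The robust approximation. -/

def feasible : Set (Fin n → ℝ) :=
  {x | x ∈ P.X ∧ P.h x ∈ nonnegPoly P.U d}

/-- The optimal value `f^min`. -/
noncomputable def fmin : EReal := ⨅ x ∈ P.feasible, ((P.c ⬝ᵥ x : ℝ) : EReal)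

def IsOptimizer (x : Fin n → ℝ) : Prop :=
  x ∈ P.feasible ∧ ∀ x' ∈ P.feasible, P.c ⬝ᵥ x ≤ P.c ⬝ᵥ x'

/-! The SOS approximation of order `k`. -/

def sosFeasible (k : ℕ) : Set (Fin n → ℝ) :=
  {x | (P.h x ∈ qmodTrunc P.g k ∧ (P.h x).totalDegree ≤ d) ∧ x ∈ P.X}

/-- The optimal value `f_k^sos`. -/
noncomputable def fsos (k : ℕ) : EReal := ⨅ x ∈ P.sosFeasible k, ((P.c ⬝ᵥ x : ℝ) : EReal)

def IsSosOptimizer (k : ℕ) (x : Fin n → ℝ) : Prop :=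
  x ∈ P.sosFeasible k ∧ ∀ x' ∈ P.sosFeasible k, P.c ⬝ᵥ x ≤ P.c ⬝ᵥ x'

/-! The moment relaxation of order `k`, in the variable `(y, z)`. -/

def momFeasible (k : ℕ) : Set (Tms r d × Tms r (2 * k)) :=
  {w | P.c - P.A.transpose.mulVec w.1 ∈ dualConeOf P.X ∧
    w.1 = w.2.truncate d ∧ w.2 ∈ momentCone P.g k}

/-- The optimal value `f_k^mom`. -/
noncomputable def fmom (k : ℕ) : EReal := ⨆ w ∈ P.momFeasible k, ((-(P.b ⬝ᵥ w.1) : ℝ) : EReal)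

def IsMomOptimizer (k : ℕ) (w : Tms r d × Tms r (2 * k)) : Prop :=
  w ∈ P.momFeasible k ∧ ∀ w' ∈ P.momFeasible k, -(P.b ⬝ᵥ w'.1) ≤ -(P.b ⬝ᵥ w.1)

/-! The algorithm. -/

/-- The initial order `k₀ = max {⌈d/2⌉, 1}` of a problem of degree `d`. -/
def initialOrder (_P : RobustProblem n r d) : ℕ := max ((d + 1) / 2) 1

/-- The stopping criterion in the loop of order `k`: no duality gap, and the rank condition
holds for the computed `z` at some `t ∈ [k₀, k]`. -/
def StopCriterion (k : ℕ) (z : Tms r (2 * k)) : Prop :=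
  P.fsos k = P.fmom k ∧
    ∃ t, P.initialOrder ≤ t ∧ t ≤ k ∧ (momentMatrix t z).rank = (momentMatrix (t - 1) z).rank

/-- One loop of the algorithm. The optimizers computed in the loop are arbitrary ones; when the
pair of relaxations has no optimizers, the algorithm passes to the next order. -/
inductive Step : AlgState n → AlgState n → Prop
  | halt (k : ℕ) (x : Fin n → ℝ) (w : Tms r d × Tms r (2 * k))
      (hx : P.IsSosOptimizer k x) (hw : P.IsMomOptimizer k w) (hcrit : P.StopCriterion k w.2) :
      Step (AlgState.loop k) (AlgState.output x (P.c ⬝ᵥ x))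
  | next (k : ℕ) (x : Fin n → ℝ) (w : Tms r d × Tms r (2 * k))
      (hx : P.IsSosOptimizer k x) (hw : P.IsMomOptimizer k w) (hcrit : ¬ P.StopCriterion k w.2) :
      Step (AlgState.loop k) (AlgState.loop (k + 1))
  | unsolvable (k : ℕ)
      (hno : ¬ ((∃ x, P.IsSosOptimizer k x) ∧ ∃ w, P.IsMomOptimizer k w)) :
      Step (AlgState.loop k) (AlgState.loop (k + 1))

/-- Started at order `k₀`, the algorithm stops after finitely many loops with output `(x, f)`. -/
def TerminatesWith (x : Fin n → ℝ) (f : ℝ) : Prop :=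
  Relation.ReflTransGen P.Step (AlgState.loop P.initialOrder) (AlgState.output x f)

end RobustProblem

open MvPolynomial Module

/-! Elements of the quadratic module are nonnegative on `U`, so a point feasible for the SOS problem
is feasible for (P). Optimality comes from weak duality: for `x` feasible for (P), cᵀx + bᵀy = (c -
Aᵀy)ᵀx + L_z(h(x)), so it suffices that L_z(h(x)) ≥ 0. The cone constraints on `z` control L_z only
on sums of squares and their multiples by `g`; the rank condition is what extends this to all
polynomials nonnegative on `U` (`riesz_nonneg_of_rank_eq`). That is flat extension. Factor the
moment matrix into Gram vectors φ(p). Flatness makes multiplication by each variable a well-defined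
operator; these operators are symmetric and commute, so φ(1) splits into joint eigenvectors u_ξ, and
L_z(p) = ∑ p(ξ)‖u_ξ‖² (`exists_orthogonal`). The localizing matrix, tested on interpolation
polynomials, forces g(ξ) ≥ 0 at each atom (`nonneg_of_localizing`). -/

theorem Finsupp.exists_add_degree_le {σ : Type*} (a b : ℕ) (α : σ →₀ ℕ)
    (h : α.degree ≤ a + b) :
    ∃ β γ : σ →₀ ℕ, β + γ = α ∧ β.degree ≤ a ∧ γ.degree ≤ b := by
  obtain ⟨β, hβ, hdeg⟩ := Finsupp.exists_le_degree_eq α (min a α.degree) (min_le_right _ _)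
  have hsum : β + (α - β) = α := add_tsub_cancel_of_le hβ
  have := congrArg Finsupp.degree hsum
  rw [map_add] at this
  exact ⟨β, α - β, hsum, by omega, by omega⟩

theorem MvPolynomial.totalDegree_monomial_le_degree {σ R : Type*} [CommSemiring R]
    (α : σ →₀ ℕ) (c : R) : (monomial α c).totalDegree ≤ α.degree :=
  totalDegree_monomial_le α c

/-- Two linear maps that agree on the monomials of degree at most `m` agree on the polynomials of
degree at most `m`. -/
theorem MvPolynomial.linearMap_eq_of_totalDegree_le {σ R M : Type*} [CommSemiring R]
    [AddCommMonoid M] [Module R M] {f g : MvPolynomial σ R →ₗ[R] M} {m : ℕ}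
    (hfg : ∀ α : σ →₀ ℕ, α.degree ≤ m → f (monomial α 1) = g (monomial α 1))
    {p : MvPolynomial σ R} (hp : p.totalDegree ≤ m) : f p = g p := by
  rw [p.as_sum, map_sum, map_sum]
  refine Finset.sum_congr rfl fun α hα => ?_
  have h : monomial α (p.coeff α) = p.coeff α • monomial α (1 : R) := by
    rw [smul_monomial, smul_eq_mul, mul_one]
  rw [h, map_smul, map_smul, hfg α ((le_totalDegree hα).trans hp)]

/-! ### Flat extension: atoms from commuting multiplication operators -/

section FlatExtension

variable {r t : ℕ} {V : Type*} [NormedAddCommGroup V] [InnerProductSpace ℝ V]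

/-- A linear functional `L` on polynomials, together with a linear map `φ` into an inner product
space that represents the bilinear form `(p, q) ↦ L (p q)` in degrees at most `t + 1`, and whose
values are all attained in degree at most `t`. -/
structure IsFlatRepresentation (t : ℕ) (L : MvPolynomial (Fin r) ℝ →ₗ[ℝ] ℝ)
    (φ : MvPolynomial (Fin r) ℝ →ₗ[ℝ] V) : Prop where
  inner_eq : ∀ p q, p.totalDegree ≤ t + 1 → q.totalDegree ≤ t + 1 →
    inner ℝ (φ p) (φ q) = L (p * q)
  exists_eq : ∀ v, ∃ q, q.totalDegree ≤ t ∧ φ q = v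

namespace IsFlatRepresentation

variable {L : MvPolynomial (Fin r) ℝ →ₗ[ℝ] ℝ} {φ : MvPolynomial (Fin r) ℝ →ₗ[ℝ] V}

theorem totalDegree_X_mul_le {q : MvPolynomial (Fin r) ℝ} (i : Fin r) (hq : q.totalDegree ≤ t) :
    (X i * q).totalDegree ≤ t + 1 := by
  have := totalDegree_mul (X i) q
  rw [totalDegree_X] at this
  omega

theorem inner_X_mul (h : IsFlatRepresentation t L φ) (i : Fin r) {p q : MvPolynomial (Fin r) ℝ}
    (hp : p.totalDegree ≤ t) (hq : q.totalDegree ≤ t) :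
    inner ℝ (φ (X i * p)) (φ q) = inner ℝ (φ p) (φ (X i * q)) := by
  rw [h.inner_eq _ _ (totalDegree_X_mul_le i hp) (by omega),
    h.inner_eq _ _ (by omega) (totalDegree_X_mul_le i hq)]
  congr 1
  ring

/-- Flatness replaces one copy of φ(X_i p) in its squared norm by φ(q) with q of degree at most `t`;
the variable then moves over to q, leaving φ(p) = 0 as a factor. -/
theorem map_X_mul_eq_zero (h : IsFlatRepresentation t L φ) (i : Fin r)
    {p : MvPolynomial (Fin r) ℝ} (hp : p.totalDegree ≤ t) (hp0 : φ p = 0) :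
    φ (X i * p) = 0 := by
  obtain ⟨q, hq, hqv⟩ := h.exists_eq (φ (X i * p))
  rw [← inner_self_eq_zero (𝕜 := ℝ)]
  nth_rw 2 [← hqv]
  rw [h.inner_X_mul i hp hq, hp0, inner_zero_left]

/-- The operators of multiplication by the variables. -/
theorem exists_mul_operators (h : IsFlatRepresentation t L φ) :
    ∃ T : Fin r → Module.End ℝ V, ∀ i q, q.totalDegree ≤ t → T i (φ q) = φ (X i * q) := by
  let W := restrictTotalDegree (Fin r) ℝ t
  have hsurj : LinearMap.range (φ ∘ₗ W.subtype) = ⊤ := by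
    rw [LinearMap.range_eq_top]
    intro v
    obtain ⟨q, hq, rfl⟩ := h.exists_eq v
    exact ⟨⟨q, (mem_restrictTotalDegree _ _ _).mpr hq⟩, rfl⟩
  -- A linear choice of representatives of degree at most `t`; by `map_X_mul_eq_zero` the product
  -- does not depend on it.
  obtain ⟨s, hs⟩ := (φ ∘ₗ W.subtype).exists_rightInverse_of_surjective hsurj
  have hs' : ∀ v, φ (s v : MvPolynomial (Fin r) ℝ) = v := fun v => LinearMap.congr_fun hs v
  refine ⟨fun i => φ ∘ₗ LinearMap.mulLeft ℝ (X i) ∘ₗ W.subtype ∘ₗ s, fun i q hq => ?_⟩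
  have hmem : (s (φ q) - q : MvPolynomial (Fin r) ℝ) ∈ W :=
    W.sub_mem (s (φ q)).2 ((mem_restrictTotalDegree _ _ _).mpr hq)
  have h0 := h.map_X_mul_eq_zero i ((mem_restrictTotalDegree _ _ _).mp hmem)
    (by rw [map_sub, hs', sub_self])
  rw [mul_sub, map_sub, sub_eq_zero] at h0
  simpa using h0

theorem isSymmetric_of_mul (h : IsFlatRepresentation t L φ) {i : Fin r} {T : Module.End ℝ V}
    (hT : ∀ q, q.totalDegree ≤ t → T (φ q) = φ (X i * q)) : LinearMap.IsSymmetric T := by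
  intro v w
  obtain ⟨p, hp, rfl⟩ := h.exists_eq v
  obtain ⟨q, hq, rfl⟩ := h.exists_eq w
  rw [hT p hp, hT q hq, h.inner_X_mul i hp hq]

/-- `S` is known only on representatives of degree at most `t`, so it cannot be evaluated directly
on φ(X_j p). Symmetry moves it to the other argument, and both orders give L(X_i X_j p q). -/
theorem commute_of_mul (h : IsFlatRepresentation t L φ) {i j : Fin r} {S T : Module.End ℝ V}
    (hS : ∀ q, q.totalDegree ≤ t → S (φ q) = φ (X i * q))
    (hT : ∀ q, q.totalDegree ≤ t → T (φ q) = φ (X j * q)) : Commute S T := by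
  refine LinearMap.ext fun v => ext_inner_right ℝ fun w => ?_
  obtain ⟨p, hp, rfl⟩ := h.exists_eq v
  obtain ⟨q, hq, rfl⟩ := h.exists_eq w
  rw [Module.End.mul_apply, Module.End.mul_apply, hT p hp, hS p hp, h.isSymmetric_of_mul hS,
    h.isSymmetric_of_mul hT, hS q hq, hT q hq,
    h.inner_eq _ _ (totalDegree_X_mul_le _ hp) (totalDegree_X_mul_le _ hq),
    h.inner_eq _ _ (totalDegree_X_mul_le _ hp) (totalDegree_X_mul_le _ hq)]
  congr 1
  ring

/-- The vectors representing polynomials are combinations, with values at points as coefficients,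
of one orthogonal family indexed by the points. -/
theorem exists_orthogonal [FiniteDimensional ℝ V] (h : IsFlatRepresentation t L φ) :
    ∃ u : (Fin r → ℝ) →₀ V, (∀ ξ η, ξ ≠ η → inner ℝ (u ξ) (u η) = 0) ∧
      ∀ p : MvPolynomial (Fin r) ℝ, p.totalDegree ≤ t + 1 →
        φ p = ∑ ξ ∈ u.support, eval ξ p • u ξ := by
  obtain ⟨T, hT⟩ := h.exists_mul_operators
  have hsymm : ∀ i, (T i).IsSymmetric := fun i => h.isSymmetric_of_mul (hT i)
  have htop := LinearMap.IsSymmetric.iSup_iInf_eq_top_of_commute hsymm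
    fun i j _ => h.commute_of_mul (hT i) (hT j)
  have horth := LinearMap.IsSymmetric.orthogonalFamily_iInf_eigenspaces hsymm
  have hone : φ 1 ∈ ⨆ χ : Fin r → ℝ, ⨅ i, Module.End.eigenspace (T i) (χ i) := htop ▸ trivial
  obtain ⟨u, hu, husum⟩ := (Submodule.mem_iSup_iff_exists_finsupp _ _).mp hone
  refine ⟨u, fun ξ η hne => horth hne ⟨u ξ, hu ξ⟩ ⟨u η, hu η⟩, fun p hp => ?_⟩
  have hmon : ∀ m (α : Fin r →₀ ℕ), α.degree = m → m ≤ t + 1 →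
      φ (monomial α 1) = ∑ ξ ∈ u.support, eval ξ (monomial α 1) • u ξ := by
    intro m
    induction m with
    | zero =>
      intro α hα _
      rw [Finsupp.degree_eq_zero_iff] at hα
      subst hα
      simpa [Finsupp.sum] using husum.symm
    | succ m ih =>
      intro α hα hm
      -- Peel off one variable: the remaining monomial has degree at most `t`, where `T i` acts as
      -- multiplication by X_i, and each u ξ is an eigenvector with eigenvalue ξ i.
      obtain ⟨i, hi⟩ : ∃ i, α i ≠ 0 := by
        by_contra! h0
        have : α = 0 := Finsupp.ext h0
        simp [this] at hα
      have hle : Finsupp.single i 1 ≤ α := by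
        rw [Finsupp.single_le_iff]
        exact Nat.one_le_iff_ne_zero.mpr hi
      have hsum : Finsupp.single i 1 + (α - Finsupp.single i 1) = α := add_tsub_cancel_of_le hle
      have hdeg := congrArg Finsupp.degree hsum
      rw [map_add, Finsupp.degree_single] at hdeg
      have hX : monomial α (1 : ℝ) = X i * monomial (α - Finsupp.single i 1) 1 := by
        rw [X, monomial_mul, hsum, mul_one]
      rw [hX, ← hT i _ ((totalDegree_monomial_le_degree _ _).trans (by omega)),
        ih _ (by omega) (by omega), map_sum]
      refine Finset.sum_congr rfl fun ξ _ => ?_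
      have hξ := (Submodule.mem_iInf _).mp (hu ξ) i
      rw [map_smul, Module.End.mem_eigenspace_iff.mp hξ, eval_mul, eval_X, smul_smul, mul_comm]
  have := linearMap_eq_of_totalDegree_le (f := φ)
    (g := ∑ ξ ∈ u.support, ((aeval ξ).toLinearMap : MvPolynomial (Fin r) ℝ →ₗ[ℝ] ℝ).smulRight (u ξ))
    (m := t + 1) (fun α hα => by
      rw [hmon _ α rfl hα]
      simp [aeval_eq_eval]) hp
  rw [this]
  simp [aeval_eq_eval]

/-- Quadrature: `L` is a nonnegative combination of point evaluations, at points where every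
polynomial `g` of degree at most two with `L (g q²) ≥ 0` is nonnegative. -/
theorem nonneg_of_localizing [FiniteDimensional ℝ V] (h : IsFlatRepresentation t L φ)
    {g : MvPolynomial (Fin r) ℝ} (hg : g.totalDegree ≤ 2)
    (hloc : ∀ q : MvPolynomial (Fin r) ℝ, q.totalDegree ≤ t → 0 ≤ L (g * (q * q)))
    {p : MvPolynomial (Fin r) ℝ} (hp : p.totalDegree ≤ (t + 1) + (t + 1))
    (hpos : ∀ ξ, 0 ≤ eval ξ g → 0 ≤ eval ξ p) : 0 ≤ L p := by
  classical
  obtain ⟨u, horth, hu⟩ := h.exists_orthogonal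
  have hinner : ∀ a b : (Fin r → ℝ) → ℝ,
      inner ℝ (∑ ξ ∈ u.support, a ξ • u ξ) (∑ ξ ∈ u.support, b ξ • u ξ) =
        ∑ ξ ∈ u.support, a ξ * b ξ * ‖u ξ‖ ^ 2 := by
    intro a b
    simp_rw [sum_inner, inner_sum, real_inner_smul_left, real_inner_smul_right]
    refine Finset.sum_congr rfl fun ξ hξ => ?_
    rw [Finset.sum_eq_single_of_mem ξ hξ fun η _ hne => by rw [horth ξ η hne.symm]; ring,
      real_inner_self_eq_norm_sq]
    ring
  have hquad : ∀ p : MvPolynomial (Fin r) ℝ, p.totalDegree ≤ (t + 1) + (t + 1) →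
      L p = ∑ ξ ∈ u.support, eval ξ p * ‖u ξ‖ ^ 2 := by
    intro p hp
    have := linearMap_eq_of_totalDegree_le (f := L)
      (g := ∑ ξ ∈ u.support,
        ((aeval ξ).toLinearMap : MvPolynomial (Fin r) ℝ →ₗ[ℝ] ℝ).smulRight (‖u ξ‖ ^ 2))
      (m := (t + 1) + (t + 1)) (fun α hα => by
        obtain ⟨β, γ, rfl, hβ, hγ⟩ := Finsupp.exists_add_degree_le _ _ α hα
        have hmul : monomial (β + γ) (1 : ℝ) = monomial β 1 * monomial γ 1 := by
          rw [monomial_mul, mul_one]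
        have hβ' := (totalDegree_monomial_le_degree β (1 : ℝ)).trans hβ
        have hγ' := (totalDegree_monomial_le_degree γ (1 : ℝ)).trans hγ
        rw [hmul, ← h.inner_eq _ _ hβ' hγ', hu _ hβ', hu _ hγ', hinner]
        simp only [← eval_mul, ← hmul]
        simp [aeval_eq_eval]) hp
    rw [this]
    simp [aeval_eq_eval]
  rw [hquad p hp]
  refine Finset.sum_nonneg fun ξ hξ => mul_nonneg (hpos ξ ?_) (sq_nonneg _)
  -- Pairing φ(q) = u ξ with every u η shows that q is 1 at ξ and 0 at the other atoms, so L(g q²) =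
  -- g(ξ)‖u ξ‖².
  obtain ⟨q, hq, hqu⟩ := h.exists_eq (u ξ)
  have hval : ∀ η ∈ u.support, eval η q = if η = ξ then 1 else 0 := by
    intro η hη
    have hη0 : ‖u η‖ ^ 2 ≠ 0 := pow_ne_zero _ (norm_ne_zero_iff.mpr (Finsupp.mem_support_iff.mp hη))
    have h1 : inner ℝ (φ q) (u η) = eval η q * ‖u η‖ ^ 2 := by
      rw [hu q (by omega), sum_inner, Finset.sum_eq_single_of_mem η hη
        fun ζ _ hne => by rw [real_inner_smul_left, horth ζ η hne, mul_zero],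
        real_inner_smul_left, real_inner_self_eq_norm_sq]
    rw [hqu] at h1
    split_ifs with heq
    · subst heq
      rw [real_inner_self_eq_norm_sq] at h1
      exact mul_right_cancel₀ hη0 (by rw [one_mul]; exact h1.symm)
    · rw [horth ξ η (Ne.symm heq)] at h1
      exact (mul_eq_zero.mp h1.symm).resolve_right hη0
  have hdeg : (g * (q * q)).totalDegree ≤ (t + 1) + (t + 1) := by
    have h1 := totalDegree_mul g (q * q)
    have h2 := totalDegree_mul q q
    omega
  have hL := hloc q hq
  rw [hquad _ hdeg, Finset.sum_eq_single_of_mem ξ hξ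
    fun η hη hne => by simp [hval η hη, hne]] at hL
  rw [eval_mul, eval_mul, hval ξ hξ, if_pos rfl, one_mul, mul_one] at hL
  exact nonneg_of_mul_nonneg_left hL
    (pow_pos (norm_pos_iff.mpr (Finsupp.mem_support_iff.mp hξ)) _)

end IsFlatRepresentation

end FlatExtension

/-! ### Moment matrices and the Riesz functional -/

/-- The coefficients of degree at most `m`, as a linear map. -/
noncomputable def coeffsLinear (r m : ℕ) : MvPolynomial (Fin r) ℝ →ₗ[ℝ] MonIdx r m → ℝ :=
  LinearMap.pi fun α => lcoeff ℝ α.1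

/-- The Riesz functional as a linear map. -/
noncomputable def rieszLinear {r e : ℕ} (z : Tms r e) : MvPolynomial (Fin r) ℝ →ₗ[ℝ] ℝ where
  toFun := riesz z
  map_add' p q := by simp [riesz, add_mul, Finset.sum_add_distrib]
  map_smul' c p := by simp [riesz, Finset.mul_sum, mul_assoc]

theorem coeff_polyOfCoeffs {r d : ℕ} (v : MonIdx r d → ℝ) (α : Fin r →₀ ℕ) :
    (polyOfCoeffs v).coeff α = if h : α.degree ≤ d then v ⟨α, h⟩ else 0 := by
  classical
  rw [polyOfCoeffs, coeff_sum]
  split_ifs with h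
  · rw [Finset.sum_eq_single_of_mem (⟨α, h⟩ : MonIdx r d) (Finset.mem_univ _)
      fun β _ hne => by rw [coeff_monomial, if_neg fun h' => hne (Subtype.ext h')]]
    simp
  · exact Finset.sum_eq_zero fun β _ => by
      rw [coeff_monomial, if_neg fun h' : β.1 = α => h (h' ▸ β.2)]

theorem polyOfCoeffs_coeffsLinear {r m : ℕ} {p : MvPolynomial (Fin r) ℝ}
    (hp : p.totalDegree ≤ m) : polyOfCoeffs (coeffsLinear r m p) = p := by
  ext α
  rw [coeff_polyOfCoeffs]
  split_ifs with h
  · rfl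
  · by_contra h0
    exact h ((le_totalDegree (mem_support_iff.mpr (Ne.symm h0))).trans hp)

theorem totalDegree_polyOfCoeffs_le {r d : ℕ} (v : MonIdx r d → ℝ) :
    (polyOfCoeffs v).totalDegree ≤ d :=
  totalDegree_finsetSum_le fun α _ => (totalDegree_monomial_le_degree _ _).trans α.2

theorem map_polyOfCoeffs {r d : ℕ} {M : Type*} [AddCommMonoid M] [Module ℝ M]
    (f : MvPolynomial (Fin r) ℝ →ₗ[ℝ] M) (v : MonIdx r d → ℝ) :
    f (polyOfCoeffs v) = ∑ α, v α • f (monomial α.1 1) := by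
  rw [polyOfCoeffs, map_sum]
  refine Finset.sum_congr rfl fun α _ => ?_
  rw [← map_smul, smul_monomial, smul_eq_mul, mul_one]

/-- A linear functional of a product, through the Gram matrix of the monomials. -/
theorem map_mul_eq_dotProduct {r m : ℕ} (f : MvPolynomial (Fin r) ℝ →ₗ[ℝ] ℝ)
    {p q : MvPolynomial (Fin r) ℝ} (hp : p.totalDegree ≤ m) (hq : q.totalDegree ≤ m) :
    f (p * q) = coeffsLinear r m p ⬝ᵥ
      (Matrix.of fun α β : MonIdx r m => f (monomial (α.1 + β.1) 1)).mulVec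
        (coeffsLinear r m q) := by
  have h1 := map_polyOfCoeffs (f ∘ₗ LinearMap.mulRight ℝ q) (coeffsLinear r m p)
  rw [polyOfCoeffs_coeffsLinear hp] at h1
  rw [show f (p * q) = (f ∘ₗ LinearMap.mulRight ℝ q) p from rfl, h1, dotProduct]
  refine Finset.sum_congr rfl fun α _ => ?_
  have h2 := map_polyOfCoeffs (f ∘ₗ LinearMap.mulLeft ℝ (monomial α.1 1)) (coeffsLinear r m q)
  rw [polyOfCoeffs_coeffsLinear hq] at h2
  rw [show (f ∘ₗ LinearMap.mulRight ℝ q) (monomial α.1 1) =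
    (f ∘ₗ LinearMap.mulLeft ℝ (monomial α.1 1)) q from rfl, h2, smul_eq_mul, Matrix.mulVec,
    dotProduct]
  congr 1
  refine Finset.sum_congr rfl fun β _ => ?_
  simp [monomial_mul, mul_comm]

theorem riesz_monomial {r e : ℕ} (z : Tms r e) {α : Fin r →₀ ℕ} (h : α.degree ≤ e) :
    riesz z (monomial α 1) = z ⟨α, h⟩ := by
  classical
  rw [riesz, Finset.sum_eq_single_of_mem (⟨α, h⟩ : MonIdx r e) (Finset.mem_univ _)
    fun β _ hne => by
      rw [coeff_monomial, if_neg fun h' => hne (Subtype.ext h'.symm), zero_mul]]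
  simp

theorem riesz_polyOfCoeffs {r d e : ℕ} (hde : d ≤ e) (z : Tms r e) (v : MonIdx r d → ℝ) :
    riesz z (polyOfCoeffs v) = v ⬝ᵥ z.truncate d := by
  refine (map_polyOfCoeffs (rieszLinear z) v).trans (Finset.sum_congr rfl fun α _ => ?_)
  rw [show rieszLinear z (monomial α.1 1) = riesz z (monomial α.1 1) from rfl,
    riesz_monomial z (α.2.trans hde), Tms.truncate, dif_pos (α.2.trans hde), smul_eq_mul]

theorem posSemidef_momentMatrix_of_le {r e s k : ℕ} (hsk : s ≤ k) {z : Tms r e}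
    (h : (momentMatrix k z).PosSemidef) : (momentMatrix s z).PosSemidef :=
  h.submatrix fun α : MonIdx r s => (⟨α.1, α.2.trans hsk⟩ : MonIdx r k)

/-- A positive semidefinite moment matrix whose rank does not grow in the last step gives a flat
representation of the Riesz functional. -/
theorem exists_isFlatRepresentation {r e t : ℕ} {z : Tms r e}
    (hpsd : (momentMatrix (t + 1) z).PosSemidef)
    (hrank : (momentMatrix (t + 1) z).rank = (momentMatrix t z).rank) :
    ∃ (V : Submodule ℝ (EuclideanSpace ℝ (MonIdx r (t + 1))))
      (φ : MvPolynomial (Fin r) ℝ →ₗ[ℝ] V), IsFlatRepresentation t (rieszLinear z) φ := by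
  classical
  let incl : MonIdx r t → MonIdx r (t + 1) := fun α => ⟨α.1, α.2.trans t.le_succ⟩
  obtain ⟨B, hB⟩ : ∃ B : Matrix (MonIdx r (t + 1)) (MonIdx r (t + 1)) ℝ,
      momentMatrix (t + 1) z = B.conjTranspose * B := by
    open scoped MatrixOrder in
    exact CStarAlgebra.nonneg_iff_eq_star_mul_self.mp hpsd.nonneg
  let B' := B.submatrix id incl
  have hB' : momentMatrix t z = B'.conjTranspose * B' := by
    have h1 : momentMatrix t z = (momentMatrix (t + 1) z).submatrix incl incl := rfl
    rw [h1, hB, Matrix.conjTranspose_submatrix]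
    exact Matrix.submatrix_mul _ _ _ id _ Function.bijective_id
  rw [hB', hB, Matrix.rank_conjTranspose_mul_self, Matrix.rank_conjTranspose_mul_self] at hrank
  have hcol : ∀ c : MonIdx r t → ℝ, B'.mulVec c = ∑ α, c α • B.col (incl α) := fun c => by
    rw [Matrix.mulVec_eq_sum]
    simp [B', Matrix.col]
    rfl
  have hle : LinearMap.range B'.mulVecLin ≤ LinearMap.range B.mulVecLin := by
    rintro _ ⟨c, rfl⟩
    rw [Matrix.mulVecLin_apply, hcol]
    refine Submodule.sum_mem _ fun α _ => Submodule.smul_mem _ _ ⟨Pi.single (incl α) 1, ?_⟩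
    simp
  -- The Gram matrices have the ranks of `B` and `B'`, so the columns of degree at most `t` already
  -- span the range of `B`.
  have hrange := Submodule.eq_of_le_of_finrank_eq hle hrank.symm
  let ψ : MvPolynomial (Fin r) ℝ →ₗ[ℝ] EuclideanSpace ℝ (MonIdx r (t + 1)) :=
    (WithLp.linearEquiv 2 ℝ (MonIdx r (t + 1) → ℝ)).symm.toLinearMap ∘ₗ B.mulVecLin ∘ₗ
      coeffsLinear r (t + 1)
  have hψ : ∀ p, ψ p = WithLp.toLp 2 (B.mulVec (coeffsLinear r (t + 1) p)) := fun p => rfl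
  -- The target is cut down to the range of ψ, so that every vector in it is attained.
  refine ⟨LinearMap.range ψ, ψ.rangeRestrict, fun p q hp hq => ?_, ?_⟩
  · rw [map_mul_eq_dotProduct (rieszLinear z) hp hq]
    change inner ℝ (ψ p) (ψ q) = _ ⬝ᵥ (momentMatrix (t + 1) z).mulVec _
    rw [hψ, hψ, EuclideanSpace.inner_toLp_toLp, hB, star_trivial, dotProduct_comm,
      ← Matrix.mulVec_mulVec, Matrix.dotProduct_mulVec _ B.conjTranspose,
      Matrix.vecMul_conjTranspose, star_trivial, star_trivial]
  · rintro ⟨_, p, rfl⟩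
    obtain ⟨c, hc⟩ : B.mulVec (coeffsLinear r (t + 1) p) ∈ LinearMap.range B'.mulVecLin :=
      hrange ▸ ⟨_, rfl⟩
    refine ⟨polyOfCoeffs c, totalDegree_polyOfCoeffs_le c, Subtype.ext ?_⟩
    change ψ (polyOfCoeffs c) = ψ p
    rw [hψ p, ← hc, Matrix.mulVecLin_apply, hcol, map_polyOfCoeffs]
    simp only [WithLp.toLp_sum, WithLp.toLp_smul, hψ]
    refine Finset.sum_congr rfl fun α _ => ?_
    congr 2
    have : coeffsLinear r (t + 1) (monomial α.1 1) = Pi.single (incl α) 1 := by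
      funext β
      simp [coeffsLinear, coeff_monomial, Pi.single_apply, incl, Subtype.ext_iff, eq_comm]
    rw [this, Matrix.mulVec_single_one]

/-- Flat truncation: a functional in the moment cone of `g` that satisfies the rank condition in
order `t` is nonnegative on the polynomials of degree at most `2t` that are nonnegative where `g`
is. -/
theorem riesz_nonneg_of_rank_eq {r k t : ℕ} {g : MvPolynomial (Fin r) ℝ} (hg : g.totalDegree ≤ 2)
    {z : Tms r (2 * k)} (hz : z ∈ momentCone g k) (ht : 1 ≤ t) (htk : t ≤ k)
    (hrank : (momentMatrix t z).rank = (momentMatrix (t - 1) z).rank)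
    {p : MvPolynomial (Fin r) ℝ} (hp : p.totalDegree ≤ 2 * t)
    (hpos : ∀ ξ, 0 ≤ eval ξ g → 0 ≤ eval ξ p) : 0 ≤ riesz z p := by
  obtain ⟨t, rfl⟩ : ∃ s, t = s + 1 := ⟨t - 1, by omega⟩
  obtain ⟨V, φ, h⟩ := exists_isFlatRepresentation (posSemidef_momentMatrix_of_le htk hz.1) hrank
  refine h.nonneg_of_localizing hg (fun q hq => ?_) (by omega) hpos
  -- Here `t + 1 ≤ k` and ⌈deg g / 2⌉ ≤ 1, so the localizing matrix reaches degree `t`.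
  have hq' : q.totalDegree ≤ k - (g.totalDegree + 1) / 2 := by omega
  have := map_mul_eq_dotProduct (rieszLinear z ∘ₗ LinearMap.mulLeft ℝ g) hq' hq'
  refine le_of_le_of_eq ?_ this.symm
  exact hz.2.dotProduct_mulVec_nonneg (coeffsLinear r _ q)

/-! ### Weak duality and correctness of the algorithm -/

namespace RobustProblem

variable {n r d : ℕ} (P : RobustProblem n r d)

theorem totalDegree_g_le : P.g.totalDegree ≤ 2 := by
  have hlin : ∀ i, (MvPolynomial.X i - C (P.μ i) : MvPolynomial (Fin r) ℝ).totalDegree ≤ 1 := fun i =>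
    (totalDegree_sub _ _).trans (by simp)
  refine (totalDegree_sub _ _).trans (max_le (by simp) ?_)
  refine totalDegree_finsetSum_le fun i _ => totalDegree_finsetSum_le fun j _ => ?_
  have h1 := totalDegree_mul (C (P.Λ⁻¹ i j))
    ((MvPolynomial.X i - C (P.μ i)) * (MvPolynomial.X j - C (P.μ j)))
  have h2 := totalDegree_mul (MvPolynomial.X i - C (P.μ i))
    (MvPolynomial.X j - C (P.μ j))
  rw [totalDegree_C] at h1
  have := hlin i
  have := hlin j
  omega

theorem eval_g (ξ : Fin r → ℝ) :
    eval ξ P.g = P.Γ - (ξ - P.μ) ⬝ᵥ (P.Λ⁻¹.mulVec (ξ - P.μ)) := by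
  simp only [g, map_sub, eval_C, map_sum, eval_mul, eval_X, dotProduct, Matrix.mulVec,
    Finset.mul_sum, Pi.sub_apply]
  congr 1
  refine Finset.sum_congr rfl fun i _ => Finset.sum_congr rfl fun j _ => by ring

theorem eval_nonneg_of_isSumSq {σ : Type*} {p : MvPolynomial σ ℝ} (hp : IsSumSq p) (ξ : σ → ℝ) :
    0 ≤ eval ξ p := by
  induction hp using IsSumSq.rec' with
  | zero => simp
  | sq_add hx _ ih =>
    obtain ⟨q, rfl⟩ := hx
    rw [map_add, map_mul]
    exact add_nonneg (mul_self_nonneg _) ih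

theorem sosFeasible_subset_feasible (k : ℕ) : P.sosFeasible k ⊆ P.feasible := by
  rintro x ⟨⟨⟨σ₀, h₀, σ₁, h₁, heq⟩, hdeg⟩, hX⟩
  refine ⟨hX, hdeg, fun ξ hξ => ?_⟩
  have hgξ : 0 ≤ eval ξ P.g := by
    rw [eval_g]
    exact hξ
  rw [heq, map_add, map_mul]
  exact add_nonneg (eval_nonneg_of_isSumSq h₀.1 ξ) (mul_nonneg hgξ (eval_nonneg_of_isSumSq h₁.1 ξ))

theorem IsSosOptimizer.fsos_eq {P : RobustProblem n r d} {k : ℕ} {x : Fin n → ℝ}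
    (hx : P.IsSosOptimizer k x) : P.fsos k = ((P.c ⬝ᵥ x : ℝ) : EReal) :=
  le_antisymm (iInf₂_le x hx.1) (le_iInf₂ fun x' hx' => EReal.coe_le_coe_iff.mpr (hx.2 x' hx'))

theorem IsMomOptimizer.fmom_eq {P : RobustProblem n r d} {k : ℕ} {w : Tms r d × Tms r (2 * k)}
    (hw : P.IsMomOptimizer k w) : P.fmom k = ((-(P.b ⬝ᵥ w.1) : ℝ) : EReal) :=
  le_antisymm (iSup₂_le fun w' hw' => EReal.coe_le_coe_iff.mpr (hw.2 w' hw'))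
    (le_iSup₂ (f := fun w (_ : w ∈ P.momFeasible k) => ((-(P.b ⬝ᵥ w.1) : ℝ) : EReal)) w hw.1)

theorem IsOptimizer.fmin_eq {P : RobustProblem n r d} {x : Fin n → ℝ} (hx : P.IsOptimizer x) :
    P.fmin = ((P.c ⬝ᵥ x : ℝ) : EReal) :=
  le_antisymm (iInf₂_le x hx.1) (le_iInf₂ fun x' hx' => EReal.coe_le_coe_iff.mpr (hx.2 x' hx'))

/-- Weak duality between the robust problem and the points of the moment relaxation that satisfy
the rank condition. -/
theorem neg_dotProduct_le_of_rank_eq {k t : ℕ} {w : Tms r d × Tms r (2 * k)}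
    (hw : w ∈ P.momFeasible k) (ht : P.initialOrder ≤ t) (htk : t ≤ k)
    (hrank : (momentMatrix t w.2).rank = (momentMatrix (t - 1) w.2).rank)
    {x : Fin n → ℝ} (hx : x ∈ P.feasible) : -(P.b ⬝ᵥ w.1) ≤ P.c ⬝ᵥ x := by
  obtain ⟨hdual, htrunc, hcone⟩ := hw
  -- ⌈d/2⌉ ≤ t gives d ≤ 2t, so h(x) is in reach of flat truncation; 1 ≤ t makes `t - 1` a true
  -- predecessor.
  rw [initialOrder, max_le_iff] at ht
  have hL : 0 ≤ riesz w.2 (P.h x) := by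
    refine riesz_nonneg_of_rank_eq P.totalDegree_g_le hcone ht.2 htk hrank
      (hx.2.1.trans (by omega)) fun ξ hξ => hx.2.2 ξ ?_
    rw [eval_g] at hξ
    exact hξ
  rw [h, riesz_polyOfCoeffs (by omega), ← htrunc, add_dotProduct] at hL
  have hx' := hdual x hx.1
  rw [sub_dotProduct, Matrix.mulVec_transpose, ← Matrix.dotProduct_mulVec,
    dotProduct_comm w.1] at hx'
  linarith

theorem isOptimizer_of_stopCriterion {k : ℕ} {x : Fin n → ℝ} {w : Tms r d × Tms r (2 * k)}
    (hx : P.IsSosOptimizer k x) (hw : P.IsMomOptimizer k w) (hcrit : P.StopCriterion k w.2) :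
    P.IsOptimizer x := by
  obtain ⟨hgap, t, ht, htk, hrank⟩ := hcrit
  rw [hx.fsos_eq, hw.fmom_eq, EReal.coe_eq_coe_iff] at hgap
  refine ⟨P.sosFeasible_subset_feasible k hx.1, fun x' hx' => ?_⟩
  rw [hgap]
  exact P.neg_dotProduct_le_of_rank_eq hw.1 ht htk hrank hx'

end RobustProblem

theorem mainTheorem2 {n r d : ℕ} (P : RobustProblem n r d)
    (hΓ : 0 < P.Γ) (hΛ : P.Λ.PosDef) (xstar : Fin n → ℝ) (fstar : ℝ)
    (hterm : P.TerminatesWith xstar fstar) :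
    P.IsOptimizer xstar ∧ fstar = P.c ⬝ᵥ xstar ∧ (fstar : EReal) = P.fmin := by
  -- The initial state is not an output, so the run has a last step, which can only be `halt`.
  obtain h | ⟨s, -, hstep⟩ := Relation.ReflTransGen.cases_tail hterm
  · exact absurd h (by simp)
  · cases hstep with
    | halt k x w hx hw hcrit =>
      have hopt := P.isOptimizer_of_stopCriterion hx hw hcrit
      exact ⟨hopt, rfl, hopt.fmin_eq.symm⟩
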